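/- For $k\in\mathbb N=\{0,1,2,\dots\}$ let $J_k$ be the Bessel function of the first kind of order $k$, and let $j_{k,n}$ ($n\ge 1$) be its $n$-th positive root. For $\kappa>0$ and $\alpha>0$ put $$F_k(\alpha)=F_{k,\kappa}(\alpha)=\frac{\kappa}{\alpha}\,J_k(\alpha)\,J_k'\Bigl(\frac{\kappa}{\alpha}\Bigr)-\alpha\,J_k\Bigl(\frac{\kappa}{\alpha}\Bigr)\,J_k'(\alpha).$$ The number $\sqrt\kappa$ is a root of $F_k$; write $\alpha_{k,0}(\kappa)=\sqrt\kappa$ and, for $\ell\ge 1$, let $\alpha_{k,\ell}(\kappa)$ be the $\ell$-th root of $F_k$ in $(\sqrt\kappa,\infty)$, in increasing order. These numbers are well defined: for every $k\in\mathbb N$, the positive roots of $J_k$ form a strictly increasing sequence $(j_{k,n})_{n\ge1}$, and for every $\kappa>0$ the roots of $F_k$ in $[\sqrt\kappa,\infty)$ form a strictly increasing sequence $(\alpha_{k,\ell}(\kappa))_{\ell\ge0}$. **Proposition.** Let $k\in\mathbb N$ and $\ell\ge1$. The set of $\kappa>0$ such that $\alpha_{k,\ell}(\kappa)=\alpha_{k+1,\ell}(\kappa)$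 is $$\{\,j_{k,n}\,j_{k,\ell+n}\mid n\ge1\,\}\cup\{\,j_{k+1,n}\,j_{k+1,\ell+n}\mid n\ge1\,\}.$$ -/

import Mathlib

noncomputable section

namespace Buckling

/-- The Bessel function of the first kind `J_k` of integer order `k ≥ 0` on the real line,
`J_k(x) = ∑_{m ≥ 0} (-1)^m / (m! (m + k)!) (x / 2)^(2 m + k)`. -/
def besselJ (k : ℕ) (x : ℝ) : ℝ :=
  ∑' m : ℕ, (-1 : ℝ) ^ m / ((m.factorial : ℝ) * ((m + k).factorial : ℝ)) * (x / 2) ^ (2 * m + k)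

/-- The `n`-th root of `f` to the right of `a`, starting with `a` itself for `n = 0`:
each further value is the least root of `f` that is larger than the previous one. -/
def nthRootAfter (f : ℝ → ℝ) (a : ℝ) : ℕ → ℝ
  | 0 => a
  | n + 1 => sInf {x : ℝ | nthRootAfter f a n < x ∧ f x = 0}

/-- `j_{k,n}`, the `n`-th positive root of `J_k` (`n ≥ 1`). -/
def besselZero (k n : ℕ) : ℝ :=
  nthRootAfter (besselJ k) 0 n

/-- `F_k(α) = (κ / α) J_k(α) J_k'(κ / α) - α J_k(κ / α) J_k'(α)`, meant for `κ > 0`, `α > 0`. -/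
def F (k : ℕ) (κ α : ℝ) : ℝ :=
  κ / α * besselJ k α * deriv (besselJ k) (κ / α) - α * besselJ k (κ / α) * deriv (besselJ k) α

/-- `α_{k,ℓ}(κ)` for `ℓ ≥ 0` and `κ > 0`: the positive roots of `F_k` are listed in increasing
order starting with `α_{k,0}(κ) = √κ`, which is itself a root, so that for `ℓ ≥ 1`
this is the `ℓ`-th root of `F_k` larger than `√κ`. -/
def alphaCurve (k ℓ : ℕ) (κ : ℝ) : ℝ :=
  nthRootAfter (F k κ) (Real.sqrt κ) ℓ

end Buckling

end

section

open Real Set Filter Topology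

namespace Buckling

/-! Write `J_k = r sin θ_k` and `x J_k' = r cos θ_k` with `r > 0` (Prüfer angle). By Bessel's
equation and an energy estimate, `θ_k` is strictly increasing and unbounded. Hence `j_{k,n}` is the
point where `θ_k = nπ`. Moreover `F_k(x)` is a positive multiple of `sin (θ_k(x) - θ_k(κ/x))`, so
`α_{k,ℓ}(κ)` is the point `x ≥ √κ` where `θ_k(x) - θ_k(κ/x) = ℓπ`.

Suppose the curves meet at `x`, and let `y = κ/x < x`. The recurrences give `F_k = xA - yB` and
`F_{k+1} = yA - xB` with `A = J_k(y) J_{k+1}(x)`, `B = J_k(x) J_{k+1}(y)`. The determinant `y² - x²`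
is nonzero, so `A = B = 0`, and `J_i(y) = 0` for `i = k` or `k + 1` (`besselJ_div_eq_zero_or`). Then
`θ_i(y) = nπ` and `θ_i(x) = (ℓ + n)π`.

Conversely, the roots of a neighbouring order are the points where `cot θ_k` has a fixed value, so
`θ_k` gains exactly `π` from each to the next. Thus `θ_k` and `θ_{k+1}` both gain `ℓπ` from
`j_{i,n}` to `j_{i,ℓ+n}` (`sub_besselZero`). -/

/-! ### Power series, derivatives and recurrences of the Bessel functions. -/

/-- The coefficients of the entire function `besselEntire k`. -/
noncomputable def besselCoeff (k m : ℕ) : ℝ :=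
  (-1 : ℝ) ^ m / ((m.factorial : ℝ) * ((m + k).factorial : ℝ))

/-- The entire function `g_k` with `J_k(x) = (x / 2)^k g_k(x² / 4)`. -/
noncomputable def besselEntire (k : ℕ) (w : ℝ) : ℝ :=
  ∑' m : ℕ, besselCoeff k m * w ^ m

lemma abs_besselCoeff_le (k m : ℕ) : |besselCoeff k m| ≤ 1 / (m.factorial : ℝ) := by
  have h1 : (1 : ℝ) ≤ ((m + k).factorial : ℝ) := by exact_mod_cast (m + k).factorial_pos
  have h2 : (0 : ℝ) < (m.factorial : ℝ) := by exact_mod_cast m.factorial_pos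
  rw [besselCoeff, abs_div, abs_pow, abs_neg, abs_one, one_pow, abs_of_pos (by positivity)]
  exact one_div_le_one_div_of_le h2 (le_mul_of_one_le_right h2.le h1)

lemma summable_besselCoeff_mul_pow (k : ℕ) (w : ℝ) :
    Summable fun m : ℕ => besselCoeff k m * w ^ m := by
  refine Summable.of_norm_bounded (Real.summable_pow_div_factorial |w|) fun m => ?_
  rw [Real.norm_eq_abs, abs_mul, abs_pow, div_eq_inv_mul, ← one_div]
  exact mul_le_mul_of_nonneg_right (abs_besselCoeff_le k m) (by positivity)

lemma succ_mul_besselCoeff_succ (k m : ℕ) :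
    ((m : ℝ) + 1) * besselCoeff k (m + 1) = -besselCoeff (k + 1) m := by
  have h : m + 1 + k = m + (k + 1) := by ring
  have h2 : (m.factorial : ℝ) ≠ 0 := by exact_mod_cast m.factorial_ne_zero
  have h3 : ((m + (k + 1)).factorial : ℝ) ≠ 0 := by exact_mod_cast Nat.factorial_ne_zero _
  rw [besselCoeff, besselCoeff, h, Nat.factorial_succ m]
  push_cast
  field_simp
  ring

lemma hasDerivAt_besselEntire (k : ℕ) (w : ℝ) :
    HasDerivAt (besselEntire k) (-besselEntire (k + 1) w) w := by
  set R : ℝ := |w| + 1 with hR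
  have hw : w ∈ Metric.ball (0 : ℝ) R := by simp [hR]
  have hu : Summable fun m : ℕ => (m : ℝ) * (1 / (m.factorial : ℝ)) * R ^ (m - 1) := by
    -- After the index shift the majorant is the exponential series at `R`.
    rw [← summable_nat_add_iff 1]
    refine (Real.summable_pow_div_factorial R).congr fun m => ?_
    have h2 : (m.factorial : ℝ) ≠ 0 := by exact_mod_cast m.factorial_ne_zero
    rw [Nat.factorial_succ, Nat.add_sub_cancel]
    push_cast
    field_simp
  have key := hasDerivAt_tsum_of_isPreconnected (𝕜 := ℝ)
    (g := fun (m : ℕ) (w : ℝ) => besselCoeff k m * w ^ m)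
    (g' := fun (m : ℕ) (w : ℝ) => besselCoeff k m * (m * w ^ (m - 1)))
    hu Metric.isOpen_ball (convex_ball (0 : ℝ) R).isPreconnected
    (fun m y _ => (hasDerivAt_pow m y).const_mul _)
    (fun m y hy => by
      have hy' : |y| ≤ R := by simpa using (mem_ball_zero_iff.mp hy).le
      rw [Real.norm_eq_abs, abs_mul, abs_mul, abs_pow, Nat.abs_cast, ← mul_assoc, mul_comm (m : ℝ)]
      gcongr
      exact abs_besselCoeff_le k m)
    hw (summable_besselCoeff_mul_pow k w) hw
  have hs : ∑' m : ℕ, besselCoeff k m * (m * w ^ (m - 1)) = -besselEntire (k + 1) w := by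
    have hterm : ∀ m : ℕ, besselCoeff k (m + 1) * (((m + 1 : ℕ) : ℝ) * w ^ (m + 1 - 1)) =
        -(besselCoeff (k + 1) m * w ^ m) := fun m => by
      have := succ_mul_besselCoeff_succ k m
      push_cast [Nat.add_sub_cancel]
      linear_combination w ^ m * this
    rw [tsum_eq_zero_add' (by
      simp_rw [hterm]; exact (summable_besselCoeff_mul_pow (k + 1) w).neg)]
    simp_rw [hterm]
    simp [tsum_neg, besselEntire]
  rw [hs] at key
  exact key

lemma besselEntire_zero_pos (k : ℕ) : 0 < besselEntire k 0 := by
  rw [besselEntire, tsum_eq_single 0 (fun m hm => by simp [hm])]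
  simp only [besselCoeff, pow_zero, mul_one, zero_add]
  positivity

lemma besselEntire_recurrence (k : ℕ) (w : ℝ) :
    ((k : ℝ) + 1) * besselEntire (k + 1) w - besselEntire k w = w * besselEntire (k + 2) w := by
  have h1 := (summable_besselCoeff_mul_pow (k + 1) w).mul_left ((k : ℝ) + 1)
  have h2 := summable_besselCoeff_mul_pow k w
  have hterm : ∀ m : ℕ, ((k : ℝ) + 1) * (besselCoeff (k + 1) (m + 1) * w ^ (m + 1)) -
      besselCoeff k (m + 1) * w ^ (m + 1) = w * (besselCoeff (k + 2) m * w ^ m) := fun m => by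
    have e1 := succ_mul_besselCoeff_succ (k + 1) m
    have e2 : besselCoeff k (m + 1) = ((m : ℝ) + 1 + k + 1) * besselCoeff (k + 1) (m + 1) := by
      have h : m + 1 + (k + 1) = (m + 1 + k) + 1 := by ring
      have h3 : ((m + 1).factorial : ℝ) ≠ 0 := by exact_mod_cast Nat.factorial_ne_zero _
      have h4 : ((m + 1 + k).factorial : ℝ) ≠ 0 := by exact_mod_cast Nat.factorial_ne_zero _
      have h5 : ((m : ℝ) + 1 + k + 1) ≠ 0 := by positivity
      rw [besselCoeff, besselCoeff, h, Nat.factorial_succ (m + 1 + k)]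
      push_cast
      field_simp
    rw [e2]
    linear_combination (-w ^ (m + 1)) * e1
  rw [besselEntire, besselEntire, besselEntire, ← tsum_mul_left, ← tsum_mul_left,
    ← h1.tsum_sub h2, (h1.sub h2).tsum_eq_zero_add]
  simp_rw [hterm]
  have h0 : besselCoeff k 0 = ((k : ℝ) + 1) * besselCoeff (k + 1) 0 := by
    have h4 : (k.factorial : ℝ) ≠ 0 := by exact_mod_cast Nat.factorial_ne_zero _
    simp only [besselCoeff, zero_add, Nat.factorial_succ k]
    push_cast
    field_simp
  simp [h0]

lemma besselJ_eq (k : ℕ) (x : ℝ) :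
    besselJ k x = (x / 2) ^ k * besselEntire k (x ^ 2 / 4) := by
  rw [besselJ, besselEntire, ← tsum_mul_left]
  refine tsum_congr fun m => ?_
  have h : x ^ 2 / 4 = (x / 2) ^ 2 := by ring
  rw [besselCoeff, h, ← pow_mul, pow_add]
  ring

lemma besselJ_recurrence (k : ℕ) (x : ℝ) :
    x * (besselJ k x + besselJ (k + 2) x) = 2 * ((k : ℝ) + 1) * besselJ (k + 1) x := by
  have := besselEntire_recurrence k (x ^ 2 / 4)
  simp only [besselJ_eq]
  linear_combination (-2 * (x / 2) ^ (k + 1)) * this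

lemma hasDerivAt_besselJ (k : ℕ) (x : ℝ) : HasDerivAt (besselJ k)
    (k * (x / 2) ^ (k - 1) * (1 / 2) * besselEntire k (x ^ 2 / 4) - besselJ (k + 1) x) x := by
  have h1 : HasDerivAt (fun x : ℝ => (x / 2) ^ k) (k * (x / 2) ^ (k - 1) * (1 / 2)) x :=
    ((hasDerivAt_id x).div_const 2).pow k
  have h2 : HasDerivAt (fun x : ℝ => x ^ 2 / 4) (x / 2) x := by
    refine ((hasDerivAt_pow 2 x).div_const 4).congr_deriv ?_
    push_cast
    ring
  have h3 := h1.mul ((hasDerivAt_besselEntire k (x ^ 2 / 4)).comp x h2)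
  rw [show besselJ k = fun x => (x / 2) ^ k * besselEntire k (x ^ 2 / 4) from
    funext (besselJ_eq k)]
  refine h3.congr_deriv ?_
  rw [besselJ_eq]
  simp only [Function.comp]
  ring

lemma mul_deriv_besselJ (k : ℕ) (x : ℝ) :
    x * deriv (besselJ k) x = k * besselJ k x - x * besselJ (k + 1) x := by
  rw [(hasDerivAt_besselJ k x).deriv, besselJ_eq k]
  rcases k with _ | k
  · simp
  · simp only [Nat.add_sub_cancel]
    ring

lemma mul_deriv_besselJ_succ (k : ℕ) (x : ℝ) :
    x * deriv (besselJ (k + 1)) x = x * besselJ k x - ((k : ℝ) + 1) * besselJ (k + 1) x := by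
  have h1 := mul_deriv_besselJ (k + 1) x
  have h2 := besselJ_recurrence k x
  push_cast at h1
  linear_combination h1 - h2

lemma differentiable_besselJ (k : ℕ) : Differentiable ℝ (besselJ k) :=
  fun x => (hasDerivAt_besselJ k x).differentiableAt

/-! ### Bessel's equation and the energy. -/

/-- The Euler derivative `x J_k'(x)` of the Bessel function. -/
noncomputable def eulerBesselJ (k : ℕ) (x : ℝ) : ℝ := x * deriv (besselJ k) x

lemma continuous_eulerBesselJ (k : ℕ) : Continuous (eulerBesselJ k) := by
  rw [show eulerBesselJ k = fun x => k * besselJ k x - x * besselJ (k + 1) x from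
    funext (mul_deriv_besselJ k)]
  exact (continuous_const.mul (differentiable_besselJ k).continuous).sub
    (continuous_id.mul (differentiable_besselJ (k + 1)).continuous)

/-- This is Bessel's equation `(x d/dx)² J_k = (k² - x²) J_k`, obtained by composing the two
first-order relations between `J_k` and `J_{k+1}`. -/
lemma hasDerivAt_eulerBesselJ (k : ℕ) {x : ℝ} (hx : x ≠ 0) :
    HasDerivAt (eulerBesselJ k) (((k : ℝ) ^ 2 - x ^ 2) * besselJ k x / x) x := by
  rw [show eulerBesselJ k = fun x => k * besselJ k x - x * besselJ (k + 1) x from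
    funext (mul_deriv_besselJ k)]
  have h1 := (differentiable_besselJ k x).hasDerivAt
  have h2 := (differentiable_besselJ (k + 1) x).hasDerivAt
  refine ((h1.const_mul (k : ℝ)).sub ((hasDerivAt_id x).mul h2)).congr_deriv ?_
  have e1 := mul_deriv_besselJ k x
  have e2 := mul_deriv_besselJ_succ k x
  simp only [id]
  rw [eq_div_iff hx]
  linear_combination (k : ℝ) * e1 - x * e2

lemma exists_besselJ_pos (k : ℕ) : ∃ a > 0, ∀ x, 0 < x → x ≤ a → 0 < besselJ k x := by
  have hc : ContinuousAt (fun x : ℝ => besselEntire k (x ^ 2 / 4)) 0 := by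
    refine ContinuousAt.comp (g := besselEntire k) ?_ (by fun_prop)
    exact (hasDerivAt_besselEntire k _).continuousAt
  have h0 : 0 < besselEntire k ((0 : ℝ) ^ 2 / 4) := by simpa using besselEntire_zero_pos k
  obtain ⟨ε, hε, h⟩ := Metric.eventually_nhds_iff.mp (hc.eventually (lt_mem_nhds h0))
  refine ⟨ε / 2, by positivity, fun x hx hxa => ?_⟩
  rw [besselJ_eq]
  have : 0 < besselEntire k (x ^ 2 / 4) := h (by
    rw [Real.dist_eq, sub_zero, abs_of_pos hx]; linarith)
  positivity

/-- The energy `(x J')² + (x² - k²) J²` is positive on the positive half-line. -/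
lemma besselEnergy_pos (k : ℕ) {x : ℝ} (hx : 0 < x) :
    0 < eulerBesselJ k x ^ 2 + (x ^ 2 - (k : ℝ) ^ 2) * besselJ k x ^ 2 := by
  set E : ℝ → ℝ := fun x => eulerBesselJ k x ^ 2 + (x ^ 2 - (k : ℝ) ^ 2) * besselJ k x ^ 2 with hE
  have hcont : Continuous E := by
    have := continuous_eulerBesselJ k
    have := (differentiable_besselJ k).continuous
    fun_prop
  have hder : ∀ y, 0 < y → HasDerivAt E (2 * y * besselJ k y ^ 2) y := fun y hy => by
    have h1 := (differentiable_besselJ k y).hasDerivAt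
    have h2 := hasDerivAt_eulerBesselJ k hy.ne'
    have h3 := (h2.pow 2).add ((((hasDerivAt_pow 2 y).sub_const ((k : ℝ) ^ 2))).mul (h1.pow 2))
    refine h3.congr_deriv ?_
    simp only [eulerBesselJ, Pi.pow_apply]
    push_cast
    field_simp
    ring
  have h0 : E 0 = 0 := by
    rcases k with _ | k
    · simp [hE, eulerBesselJ]
    · simp [hE, eulerBesselJ, besselJ_eq]
  obtain ⟨a, ha, hpos⟩ := exists_besselJ_pos k
  have hmono : MonotoneOn E (Ici 0) := by
    refine monotoneOn_of_deriv_nonneg (convex_Ici 0) hcont.continuousOn ?_ ?_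
    · rw [interior_Ici]
      exact fun y hy => (hder y hy).differentiableAt.differentiableWithinAt
    · rw [interior_Ici]
      intro y hy
      have hy' : 0 < y := hy
      rw [(hder y hy).deriv]
      positivity
  -- Near `0`, where `J_k > 0`, the energy strictly leaves its initial value `0`; beyond that,
  -- monotonicity suffices.
  have hstrict : StrictMonoOn E (Icc 0 a) := by
    refine strictMonoOn_of_deriv_pos (convex_Icc 0 a) hcont.continuousOn ?_
    rw [interior_Icc]
    intro y hy
    have h2 := hpos y hy.1 hy.2.le
    have h3 := hy.1
    rw [(hder y hy.1).deriv]
    positivity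
  have hm : 0 < min x a := lt_min hx ha
  calc 0 = E 0 := h0.symm
    _ < E (min x a) := hstrict ⟨le_rfl, ha.le⟩ ⟨hm.le, min_le_right _ _⟩ hm
    _ ≤ E x := hmono hm.le hx.le (min_le_left _ _)

lemma besselJ_norm_pos (k : ℕ) {x : ℝ} (hx : 0 < x) :
    0 < besselJ k x ^ 2 + eulerBesselJ k x ^ 2 := by
  have h := besselEnergy_pos k hx
  rcases eq_or_ne (besselJ k x) 0 with h0 | h0
  · rw [h0] at h ⊢
    simpa using h
  · positivity

/-! ### Continuous choice of a polar angle. -/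

/-- Polar coordinates along a plane curve `(v, u)`: a differentiable choice of the angle. -/
lemma exists_phase {u v u' v' : ℝ → ℝ} (hu : ∀ t, HasDerivAt u (u' t) t)
    (hv : ∀ t, HasDerivAt v (v' t) t) (hu' : Continuous u') (hv' : Continuous v')
    (hne : ∀ t, 0 < u t ^ 2 + v t ^ 2) (t₀ : ℝ) :
    ∃ θ : ℝ → ℝ, (∀ t, HasDerivAt θ ((v t * u' t - u t * v' t) / (u t ^ 2 + v t ^ 2)) t) ∧
      (∀ t, u t = √(u t ^ 2 + v t ^ 2) * sin (θ t)) ∧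
      (∀ t, v t = √(u t ^ 2 + v t ^ 2) * cos (θ t)) ∧ θ t₀ ∈ Ioc (-π) π := by
  have hcu : Continuous u := continuous_iff_continuousAt.mpr fun t => (hu t).continuousAt
  have hcv : Continuous v := continuous_iff_continuousAt.mpr fun t => (hv t).continuousAt
  set ω : ℝ → ℝ := fun t => (v t * u' t - u t * v' t) / (u t ^ 2 + v t ^ 2) with hω
  have hωc : Continuous ω := by
    refine Continuous.div (by fun_prop) (by fun_prop) fun t => (hne t).ne'
  set r : ℝ → ℝ := fun t => √(u t ^ 2 + v t ^ 2) with hr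
  have hrpos : ∀ t, 0 < r t := fun t => sqrt_pos.mpr (hne t)
  have hrsq : ∀ t, r t ^ 2 = u t ^ 2 + v t ^ 2 := fun t => sq_sqrt (hne t).le
  set z : ℂ := ⟨v t₀, u t₀⟩ with hz
  have hnz : ‖z‖ = r t₀ := by
    rw [Complex.norm_def, Complex.normSq_mk, hr]
    congr 1
    ring
  have hz0 : z ≠ 0 := by
    rw [← norm_pos_iff, hnz]
    exact hrpos t₀
  set θ : ℝ → ℝ := fun t => Complex.arg z + ∫ s in t₀..t, ω s with hθ
  have hθ0 : θ t₀ = Complex.arg z := by simp [hθ]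
  have hθd : ∀ t, HasDerivAt θ (ω t) t := fun t =>
    (hωc.integral_hasStrictDerivAt t₀ t).hasDerivAt.const_add _
  have hrd : ∀ t, HasDerivAt r ((u t * u' t + v t * v' t) / r t) t := fun t => by
    have h := (((hu t).pow 2).add ((hv t).pow 2)).sqrt (hne t).ne'
    refine h.congr_deriv ?_
    have := (hrpos t).ne'
    change _ / (2 * r t) = _
    field_simp
    push_cast
    ring
  have hUd : ∀ t, HasDerivAt (fun t => u t / r t) (v t / r t * ω t) t := fun t => by
    refine ((hu t).div (hrd t) (hrpos t).ne').congr_deriv ?_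
    have h1 := (hrpos t).ne'
    have h2 := hrsq t
    simp only [hω, ← h2]
    field_simp
    rw [h2]
    ring
  have hVd : ∀ t, HasDerivAt (fun t => v t / r t) (-(u t / r t) * ω t) t := fun t => by
    refine ((hv t).div (hrd t) (hrpos t).ne').congr_deriv ?_
    have h1 := (hrpos t).ne'
    have h2 := hrsq t
    simp only [hω, ← h2]
    field_simp
    rw [h2]
    ring
  -- Squared distance between two unit vectors rotating at the same rate `ω`; it is constant and
  -- starts at `0`.
  set d : ℝ → ℝ := fun t => (u t / r t - sin (θ t)) ^ 2 + (v t / r t - cos (θ t)) ^ 2 with hd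
  have hdd : ∀ t, HasDerivAt d 0 t := fun t => by
    have h := (((hUd t).sub (hθd t).sin).pow 2).add (((hVd t).sub (hθd t).cos).pow 2)
    refine h.congr_deriv ?_
    simp only [Pi.sub_apply]
    push_cast
    ring
  have hd0 : d t₀ = 0 := by
    have h1 : sin (θ t₀) = u t₀ / r t₀ := by rw [hθ0, Complex.sin_arg, hnz]
    have h2 : cos (θ t₀) = v t₀ / r t₀ := by rw [hθ0, Complex.cos_arg hz0, hnz]
    simp [hd, h1, h2]
  have hdz : ∀ t, d t = 0 := fun t => by
    rw [← hd0]
    exact is_const_of_deriv_eq_zero (fun s => (hdd s).differentiableAt) (fun s => (hdd s).deriv) _ _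
  refine ⟨θ, hθd, fun t => ?_, fun t => ?_, hθ0 ▸ Complex.arg_mem_Ioc z⟩
  · have h1 : u t / r t - sin (θ t) = 0 := by
      have := hdz t
      simp only [hd] at this
      nlinarith [sq_nonneg (u t / r t - sin (θ t)), sq_nonneg (v t / r t - cos (θ t))]
    have h2 := (hrpos t).ne'
    change u t = r t * _
    rw [← sub_eq_zero.mp h1]
    field_simp
  · have h1 : v t / r t - cos (θ t) = 0 := by
      have := hdz t
      simp only [hd] at this
      nlinarith [sq_nonneg (u t / r t - sin (θ t)), sq_nonneg (v t / r t - cos (θ t))]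
    have h2 := (hrpos t).ne'
    change v t = r t * _
    rw [← sub_eq_zero.mp h1]
    field_simp

/-! ### Enumerating roots by a phase. -/

/-- If `f` is strictly increasing on `[a, ∞)`, attains the values `f a + n π`, and the roots of `q`
beyond `a` are the points where `f - f a` is a multiple of `π`, then the `n`-th root of `q` after
`a` is the point where `f` has grown by `n π`. -/
lemma nthRootAfter_phase {f q : ℝ → ℝ} {a : ℝ} (hf : StrictMonoOn f (Ici a))
    (hsurj : ∀ n : ℕ, ∃ x, a ≤ x ∧ f x = f a + n * π)
    (hq : ∀ x, a < x → (q x = 0 ↔ sin (f x - f a) = 0)) (n : ℕ) :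
    a ≤ nthRootAfter q a n ∧ f (nthRootAfter q a n) = f a + n * π := by
  induction n with
  | zero => simp [nthRootAfter]
  | succ n ih =>
    obtain ⟨ha, hfn⟩ := ih
    obtain ⟨x, hax, hfx⟩ := hsurj (n + 1)
    push_cast at hfx ⊢
    have hnx : nthRootAfter q a n < x :=
      (hf.lt_iff_lt ha hax).mp (by rw [hfn, hfx]; nlinarith [pi_pos])
    have hleast : IsLeast {x : ℝ | nthRootAfter q a n < x ∧ q x = 0} x := by
      refine ⟨⟨hnx, (hq x (ha.trans_lt hnx)).mpr ?_⟩, ?_⟩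
      · rw [hfx, sin_eq_zero_iff]
        exact ⟨n + 1, by push_cast; ring⟩
      · rintro y ⟨hy, hqy⟩
        have hay : a < y := ha.trans_lt hy
        obtain ⟨m, hm⟩ := sin_eq_zero_iff.mp ((hq y hay).mp hqy)
        have h1 := hf ha hay.le hy
        have h2 : (n : ℝ) * π < m * π := by linarith
        have h3 : (n : ℤ) < m := by exact_mod_cast lt_of_mul_lt_mul_right h2 pi_pos.le
        have h4 : ((n : ℝ) + 1) ≤ m := by exact_mod_cast h3
        refine (hf.le_iff_le hax hay.le).mp ?_
        rw [hfx]
        nlinarith [pi_pos]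
    rw [nthRootAfter, hleast.csInf_eq]
    exact ⟨hax, hfx⟩

lemma nthRootAfter_eq_of_phase {f q : ℝ → ℝ} {a : ℝ} (hf : StrictMonoOn f (Ici a))
    (hsurj : ∀ n : ℕ, ∃ x, a ≤ x ∧ f x = f a + n * π)
    (hq : ∀ x, a < x → (q x = 0 ↔ sin (f x - f a) = 0)) {x : ℝ} (hx : a ≤ x) {n : ℕ} (h : f x = f a + n * π) :
    nthRootAfter q a n = x := by
  obtain ⟨h1, h2⟩ := nthRootAfter_phase hf hsurj hq n
  exact hf.injOn h1 hx (h2.trans h.symm)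

lemma strictMono_nthRootAfter {f q : ℝ → ℝ} {a : ℝ} (hf : StrictMonoOn f (Ici a))
    (hsurj : ∀ n : ℕ, ∃ x, a ≤ x ∧ f x = f a + n * π)
    (hq : ∀ x, a < x → (q x = 0 ↔ sin (f x - f a) = 0)) : StrictMono (nthRootAfter q a) := fun m n hmn => by
  obtain ⟨h1, h2⟩ := nthRootAfter_phase hf hsurj hq m
  obtain ⟨h3, h4⟩ := nthRootAfter_phase hf hsurj hq n
  refine (hf.lt_iff_lt h1 h3).mp ?_
  rw [h2, h4]
  have : (m : ℝ) < n := by exact_mod_cast hmn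
  nlinarith [pi_pos]

lemma eq_zero_iff_exists_nthRootAfter {f q : ℝ → ℝ} {a : ℝ} (hf : StrictMonoOn f (Ici a))
    (hsurj : ∀ n : ℕ, ∃ x, a ≤ x ∧ f x = f a + n * π)
    (hq : ∀ x, a < x → (q x = 0 ↔ sin (f x - f a) = 0)) {x : ℝ} (hx : a < x) :
    q x = 0 ↔ ∃ n : ℕ, nthRootAfter q a (n + 1) = x := by
  constructor
  · intro h
    obtain ⟨m, hm⟩ := sin_eq_zero_iff.mp ((hq x hx).mp h)
    have h1 := hf self_mem_Ici hx.le hx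
    have h2 : (0 : ℝ) < m := by
      by_contra! h
      nlinarith [pi_pos]
    have h3 : 0 < m := by exact_mod_cast h2
    obtain ⟨n, rfl⟩ : ∃ n : ℕ, m = n + 1 := ⟨(m - 1).toNat, by omega⟩
    refine ⟨n, nthRootAfter_eq_of_phase hf hsurj hq hx.le ?_⟩
    push_cast at hm ⊢
    linarith
  · rintro ⟨n, rfl⟩
    rw [hq _ hx, (nthRootAfter_phase hf hsurj hq (n + 1)).2, sin_eq_zero_iff]
    exact ⟨n + 1, by push_cast; ring⟩

/-! ### The Prüfer angle of `J_k`. -/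

/-- A Prüfer angle of `J_k` on the positive half-line, extended by its value `0` at the origin. -/
structure IsBesselPhase (k : ℕ) (θ : ℝ → ℝ) : Prop where
  strictMonoOn : StrictMonoOn θ (Ici 0)
  continuousOn : ContinuousOn θ (Ioi 0)
  map_zero : θ 0 = 0
  tendsto : Tendsto θ atTop atTop
  exists_lt_pi : ∃ a > 0, θ a < π
  polar : ∀ x, 0 < x → ∃ r > 0, besselJ k x = r * sin (θ x) ∧ eulerBesselJ k x = r * cos (θ x)

/-- In the variable `t = log x` the angle has speed energy over `J² + (x J')²`, which is positive.
It stays positive as `t → -∞` because `sin φ > 0` there, so the value `0` at the origin keeps it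
strictly increasing. -/
lemma exists_isBesselPhase (k : ℕ) : ∃ θ : ℝ → ℝ, IsBesselPhase k θ := by
  obtain ⟨a, ha, hpos⟩ := exists_besselJ_pos k
  have hJc := (differentiable_besselJ k).continuous
  have hEc := continuous_eulerBesselJ k
  have hu : ∀ t, HasDerivAt (fun t => besselJ k (exp t)) (eulerBesselJ k (exp t)) t := fun t => by
    refine ((differentiable_besselJ k (exp t)).hasDerivAt.comp t (hasDerivAt_exp t)).congr_deriv ?_
    rw [eulerBesselJ, mul_comm]
  have hv : ∀ t, HasDerivAt (fun t => eulerBesselJ k (exp t))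
      (((k : ℝ) ^ 2 - exp t ^ 2) * besselJ k (exp t)) t := fun t => by
    refine ((hasDerivAt_eulerBesselJ k (exp_pos t).ne').comp t (hasDerivAt_exp t)).congr_deriv ?_
    have := (exp_pos t).ne'
    field_simp
  obtain ⟨φ, hφd, hφs, hφc, hφ0⟩ := exists_phase hu hv (by fun_prop) (by fun_prop)
    (fun t => besselJ_norm_pos k (exp_pos t)) (log a)
  have hr : ∀ t, 0 < √(besselJ k (exp t) ^ 2 + eulerBesselJ k (exp t) ^ 2) :=
    fun t => sqrt_pos.mpr (besselJ_norm_pos k (exp_pos t))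
  have hφcont : Continuous φ := continuous_iff_continuousAt.mpr fun t => (hφd t).continuousAt
  have hmono : StrictMono φ := strictMono_of_deriv_pos fun t => by
    rw [(hφd t).deriv]
    refine div_pos ?_ (besselJ_norm_pos k (exp_pos t))
    have := besselEnergy_pos k (exp_pos t)
    nlinarith
  have hsin : ∀ t, t ≤ log a → 0 < sin (φ t) := fun t ht => by
    have h1 := hpos (exp t) (exp_pos t) ((le_log_iff_exp_le ha).mp ht)
    rw [hφs t] at h1
    exact pos_of_mul_pos_right h1 (hr t).le
  have hφ0pos : 0 < φ (log a) := by
    by_contra! h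
    exact (sin_nonpos_of_nonpos_of_neg_pi_le h hφ0.1.le).not_gt (hsin _ le_rfl)
  have hφpos : ∀ t, 0 < φ t := fun t => by
    by_contra! h
    have hta : t ≤ log a := by
      by_contra! h'
      exact (hφ0pos.trans (hmono h')).not_ge h
    obtain ⟨s, hs, hs0⟩ := intermediate_value_Icc hta hφcont.continuousOn ⟨h, hφ0pos.le⟩
    have := hsin s hs.2
    rw [hs0, sin_zero] at this
    exact this.false
  have hφlt : φ (log a) < π := by
    refine lt_of_le_of_ne hφ0.2 fun h => ?_
    have := hsin _ le_rfl
    rw [h, sin_pi] at this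
    exact this.false
  have htend : Tendsto φ atTop atTop := by
    -- Beyond `T`, `exp t ^ 2 ≥ k² + 1`, which makes the angular speed at least `1`.
    set T : ℝ := (k : ℝ) ^ 2 + 1 with hT
    have hge : ∀ t ∈ Ici T, φ T + (t - T) ≤ φ t := fun t ht => by
      have := (convex_Ici T).mul_sub_le_image_sub_of_le_deriv (f := φ) (C := 1)
        hφcont.continuousOn (fun s _ => (hφd s).differentiableAt.differentiableWithinAt)
        (fun s hs => ?_) T self_mem_Ici t ht ht
      · linarith
      · rw [interior_Ici] at hs
        have hs' : T < s := hs
        rw [(hφd s).deriv, le_div_iff₀ (besselJ_norm_pos k (exp_pos s)), one_mul]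
        have h1 : (k : ℝ) ^ 2 + 1 ≤ exp s := by linarith [add_one_le_exp s]
        have h2 : (k : ℝ) ^ 2 + 1 ≤ exp s ^ 2 := by nlinarith [sq_nonneg (k : ℝ)]
        nlinarith [sq_nonneg (besselJ k (exp s))]
    refine tendsto_atTop_mono' atTop ((eventually_ge_atTop T).mono hge) ?_
    exact tendsto_atTop_add_const_left _ _ (tendsto_atTop_add_const_right _ _ tendsto_id)
  have hval : ∀ x : ℝ, 0 < x → (if x ≤ 0 then 0 else φ (log x)) = φ (log x) :=
    fun x hx => if_neg hx.not_ge
  refine ⟨fun x => if x ≤ 0 then 0 else φ (log x), ?_, ?_, by simp, ?_, ⟨a, ha, ?_⟩, ?_⟩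
  · intro x hx y _ hxy
    have hx' : (0 : ℝ) ≤ x := hx
    have hy' : 0 < y := hx'.trans_lt hxy
    beta_reduce
    rw [hval y hy']
    rcases hx'.eq_or_lt with rfl | hx0
    · simpa using hφpos _
    · rw [hval x hx0]
      exact hmono (log_lt_log hx0 hxy)
  · refine ContinuousOn.congr (f := fun x => φ (log x)) ?_ fun x hx => hval x hx
    exact hφcont.comp_continuousOn (continuousOn_log.mono fun x hx => (ne_of_gt hx))
  · refine (htend.comp tendsto_log_atTop).congr' ?_
    filter_upwards [eventually_gt_atTop 0] with x hx
    exact (hval x hx).symm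
  · simpa only [hval a ha] using hφlt
  · intro x hx
    refine ⟨_, hr (log x), ?_⟩
    have h1 := hφs (log x)
    have h2 := hφc (log x)
    rw [hval x hx]
    rw [exp_log hx] at h1 h2 ⊢
    exact ⟨h1, h2⟩

/-- On a half-line, a continuous function tending to infinity takes all values above its
initial value. -/
lemma exists_ge_eq_of_tendsto {f : ℝ → ℝ} {a c : ℝ} (hf : ContinuousOn f (Ici a))
    (ht : Tendsto f atTop atTop) (hc : f a ≤ c) : ∃ x, a ≤ x ∧ f x = c := by
  obtain ⟨b, hb, hab⟩ := ((ht.eventually_ge_atTop c).and (eventually_ge_atTop a)).exists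
  obtain ⟨x, hx, hfx⟩ := intermediate_value_Icc hab (hf.mono Icc_subset_Ici_self) ⟨hc, hb⟩
  exact ⟨x, hx.1, hfx⟩

namespace IsBesselPhase

variable {k : ℕ} {θ : ℝ → ℝ}

lemma strictMonoOn_Ici (h : IsBesselPhase k θ) {a : ℝ} (ha : 0 ≤ a) : StrictMonoOn θ (Ici a) :=
  h.strictMonoOn.mono (Ici_subset_Ici.mpr ha)

lemma exists_eq_add (h : IsBesselPhase k θ) {a : ℝ} (ha : 0 ≤ a) (n : ℕ) :
    ∃ x, a ≤ x ∧ θ x = θ a + n * π := by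
  rcases ha.eq_or_lt with rfl | ha
  · rcases n with _ | n
    · exact ⟨0, le_rfl, by simp⟩
    -- The angle may jump at `0` (for `J_0` it tends to `π/2`), so the intermediate value theorem
    -- starts from a point `b > 0` with angle below `π`.
    · obtain ⟨b, hb, hbπ⟩ := h.exists_lt_pi
      obtain ⟨x, hx, hθx⟩ := exists_ge_eq_of_tendsto (f := θ) (a := b) (c := θ 0 + (n + 1 : ℕ) * π)
        (h.continuousOn.mono fun x hx => lt_of_lt_of_le hb hx) h.tendsto (by
          rw [h.map_zero]
          push_cast
          nlinarith [pi_pos, (Nat.cast_nonneg n : (0 : ℝ) ≤ n)])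
      exact ⟨x, hb.le.trans hx, hθx⟩
  · refine exists_ge_eq_of_tendsto (h.continuousOn.mono fun x hx => lt_of_lt_of_le ha hx)
      h.tendsto ?_
    have := pi_pos
    have : 0 ≤ (n : ℝ) * π := by positivity
    linarith

lemma besselJ_eq_zero_iff (h : IsBesselPhase k θ) {x : ℝ} (hx : 0 < x) :
    besselJ k x = 0 ↔ sin (θ x) = 0 := by
  obtain ⟨r, hr, h1, -⟩ := h.polar x hx
  rw [h1, mul_eq_zero, or_iff_right hr.ne']

/-- `F` is the cross product of the vectors `(x J', J)` at `κ / x` and at `x`. -/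
lemma F_eq_zero_iff (h : IsBesselPhase k θ) {κ x : ℝ} (hκ : 0 < κ) (hx : 0 < x) :
    F k κ x = 0 ↔ sin (θ x - θ (κ / x)) = 0 := by
  obtain ⟨r, hr, h1, h2⟩ := h.polar x hx
  obtain ⟨s, hs, h3, h4⟩ := h.polar (κ / x) (div_pos hκ hx)
  have : F k κ x = r * s * sin (θ x - θ (κ / x)) := by
    have e : F k κ x =
        besselJ k x * eulerBesselJ k (κ / x) - besselJ k (κ / x) * eulerBesselJ k x := by
      simp only [F, eulerBesselJ]
      ring
    rw [e, h1, h2, h3, h4, sin_sub]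
    ring
  rw [this, mul_eq_zero, or_iff_right (mul_pos hr hs).ne']

end IsBesselPhase

/-! ### Roots of neighbouring orders seen by one angle. -/

/-- Two angles with the same slope `cos + m sin = 0` differ by a multiple of `π`. -/
lemma cos_add_mul_sin_eq_zero_iff {m A X : ℝ} (hA : cos A + m * sin A = 0) :
    cos X + m * sin X = 0 ↔ sin (X - A) = 0 := by
  have hs : sin A ≠ 0 := fun h => by
    have h1 := sin_sq_add_cos_sq A
    have h2 : cos A = 0 := by simpa [h] using hA
    simp [h, h2] at h1
  have e : sin (X - A) = -sin A * (cos X + m * sin X) := by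
    rw [sin_sub]
    linear_combination sin X * hA
  rw [e, mul_eq_zero, or_iff_right (neg_ne_zero.mpr hs)]

/-- `θ` counts the roots of `J_k`: it grows by multiples of `π` exactly between those roots. -/
def CountsRoots (k : ℕ) (θ : ℝ → ℝ) : Prop :=
  ∀ a x, 0 < a → 0 < x → besselJ k a = 0 → (besselJ k x = 0 ↔ sin (θ x - θ a) = 0)

namespace IsBesselPhase

variable {k : ℕ} {θ : ℝ → ℝ}

lemma countsRoots (h : IsBesselPhase k θ) : CountsRoots k θ := fun a x ha hx hJ => by
  have h1 := (h.besselJ_eq_zero_iff ha).mp hJ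
  have hc : cos (θ a) ≠ 0 := fun h0 => by
    have := sin_sq_add_cos_sq (θ a)
    simp [h1, h0] at this
  rw [h.besselJ_eq_zero_iff hx, sin_sub, h1, mul_zero, sub_zero, mul_eq_zero, or_iff_left hc]

/-- Since `x J_k = x J_{k+1}' + (k+1) J_{k+1}`, the roots of `J_k` are where `cot θ = -(k+1)`. -/
lemma countsRoots_pred (h : IsBesselPhase (k + 1) θ) : CountsRoots k θ := by
  have key : ∀ x, 0 < x → (besselJ k x = 0 ↔ cos (θ x) + (k + 1 : ℝ) * sin (θ x) = 0) :=
    fun x hx => by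
      obtain ⟨r, hr, h1, h2⟩ := h.polar x hx
      have e := mul_deriv_besselJ_succ k x
      have e' : x * besselJ k x = r * (cos (θ x) + (k + 1 : ℝ) * sin (θ x)) := by
        rw [eulerBesselJ] at h2
        linear_combination h2 - e + (k + 1 : ℝ) * h1
      rw [← mul_eq_zero_iff_left hx.ne', e', mul_eq_zero, or_iff_right hr.ne']
  intro a x ha hx hJ
  rw [key x hx]
  exact cos_add_mul_sin_eq_zero_iff ((key a ha).mp hJ)

/-- Since `x J_{k+1} = k J_k - x J_k'`, the roots of `J_{k+1}` are where `cot θ = k`. -/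
lemma countsRoots_succ (h : IsBesselPhase k θ) : CountsRoots (k + 1) θ := by
  have key : ∀ x, 0 < x → (besselJ (k + 1) x = 0 ↔ cos (θ x) + (-k : ℝ) * sin (θ x) = 0) :=
    fun x hx => by
      obtain ⟨r, hr, h1, h2⟩ := h.polar x hx
      have e := mul_deriv_besselJ k x
      have e' : x * besselJ (k + 1) x = -r * (cos (θ x) + (-k : ℝ) * sin (θ x)) := by
        rw [eulerBesselJ] at h2
        linear_combination e - h2 + (k : ℝ) * h1
      rw [← mul_eq_zero_iff_left hx.ne', e', mul_eq_zero,
        or_iff_right (neg_ne_zero.mpr hr.ne')]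
  intro a x ha hx hJ
  rw [key x hx]
  exact cos_add_mul_sin_eq_zero_iff ((key a ha).mp hJ)

/-! ### Bessel zeros and the curves `α` in terms of the angle. -/

lemma besselJ_eq_zero_iff_sub (h : IsBesselPhase k θ) (x : ℝ) (hx : 0 < x) :
    besselJ k x = 0 ↔ sin (θ x - θ 0) = 0 := by
  rw [h.map_zero, sub_zero, h.besselJ_eq_zero_iff hx]

lemma phase_besselZero (h : IsBesselPhase k θ) (n : ℕ) : θ (besselZero k n) = n * π := by
  have := (nthRootAfter_phase (h.strictMonoOn_Ici le_rfl) (h.exists_eq_add le_rfl)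
    h.besselJ_eq_zero_iff_sub n).2
  rwa [h.map_zero, zero_add] at this

lemma besselZero_eq (h : IsBesselPhase k θ) {x : ℝ} (hx : 0 ≤ x) {n : ℕ} (hn : θ x = n * π) :
    besselZero k n = x :=
  nthRootAfter_eq_of_phase (h.strictMonoOn_Ici le_rfl) (h.exists_eq_add le_rfl)
    h.besselJ_eq_zero_iff_sub hx (by rw [h.map_zero, zero_add, hn])

lemma strictMono_besselZero (h : IsBesselPhase k θ) : StrictMono (besselZero k) :=
  strictMono_nthRootAfter (h.strictMonoOn_Ici le_rfl) (h.exists_eq_add le_rfl) h.besselJ_eq_zero_iff_sub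

lemma besselJ_eq_zero_iff_exists (h : IsBesselPhase k θ) {x : ℝ} (hx : 0 < x) :
    besselJ k x = 0 ↔ ∃ n : ℕ, besselZero k (n + 1) = x :=
  eq_zero_iff_exists_nthRootAfter (h.strictMonoOn_Ici le_rfl) (h.exists_eq_add le_rfl)
    h.besselJ_eq_zero_iff_sub hx

section alpha

variable {κ : ℝ}

lemma strictMonoOn_sub (h : IsBesselPhase k θ) (hκ : 0 < κ) :
    StrictMonoOn (fun x => θ x - θ (κ / x)) (Ici √κ) := by
  have hs := sqrt_pos.mpr hκ
  intro x hx y hy hxy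
  have hx' : 0 < x := lt_of_lt_of_le hs hx
  have hy' : 0 < y := lt_of_lt_of_le hs hy
  have h1 := h.strictMonoOn hx'.le hy'.le hxy
  have h2 := h.strictMonoOn (div_pos hκ hy').le (div_pos hκ hx').le
    (div_lt_div_of_pos_left hκ hx' hxy)
  change θ x - θ (κ / x) < θ y - θ (κ / y)
  linarith

lemma sub_sqrt : θ √κ - θ (κ / √κ) = 0 := by
  rw [div_sqrt, sub_self]

lemma exists_sub_eq_add (h : IsBesselPhase k θ) (hκ : 0 < κ) (n : ℕ) :
    ∃ x, √κ ≤ x ∧ θ x - θ (κ / x) = θ √κ - θ (κ / √κ) + n * π := by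
  have hs := sqrt_pos.mpr hκ
  have hpos : ∀ x ∈ Ici √κ, 0 < x := fun x hx => lt_of_lt_of_le hs hx
  refine exists_ge_eq_of_tendsto (f := fun x => θ x - θ (κ / x)) ?_ ?_ ?_
  · refine (h.continuousOn.mono hpos).sub (h.continuousOn.comp ?_ fun x hx => ?_)
    · exact continuousOn_const.div continuousOn_id fun x hx => (hpos x hx).ne'
    · exact div_pos hκ (hpos x hx)
  · refine tendsto_atTop_mono' atTop ?_
      (tendsto_atTop_add_const_right _ (-θ √κ) h.tendsto)
    filter_upwards [eventually_ge_atTop √κ] with x hx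
    have h1 : κ / x ≤ √κ := by
      rw [div_le_iff₀ (hpos x hx)]
      nlinarith [mul_self_sqrt hκ.le]
    have := h.strictMonoOn.monotoneOn (div_pos hκ (hpos x hx)).le hs.le h1
    linarith
  · have := pi_pos
    have : 0 ≤ (n : ℝ) * π := by positivity
    linarith

lemma F_iff (h : IsBesselPhase k θ) (hκ : 0 < κ) (x : ℝ) (hx : √κ < x) :
    F k κ x = 0 ↔ sin ((θ x - θ (κ / x)) - (θ √κ - θ (κ / √κ))) = 0 := by
  rw [sub_sqrt, sub_zero, h.F_eq_zero_iff hκ ((sqrt_pos.mpr hκ).trans hx)]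

lemma alphaCurve_spec (h : IsBesselPhase k θ) (hκ : 0 < κ) (n : ℕ) :
    θ (alphaCurve k n κ) - θ (κ / alphaCurve k n κ) = n * π := by
  have := (nthRootAfter_phase (h.strictMonoOn_sub hκ) (h.exists_sub_eq_add hκ) (h.F_iff hκ) n).2
  rwa [sub_sqrt, zero_add] at this

lemma alphaCurve_eq (h : IsBesselPhase k θ) (hκ : 0 < κ) {x : ℝ} (hx : √κ ≤ x) {n : ℕ}
    (hn : θ x - θ (κ / x) = n * π) : alphaCurve k n κ = x :=
  nthRootAfter_eq_of_phase (h.strictMonoOn_sub hκ) (h.exists_sub_eq_add hκ) (h.F_iff hκ) hx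
    (by rw [sub_sqrt, zero_add, hn])

lemma strictMono_alphaCurve (h : IsBesselPhase k θ) (hκ : 0 < κ) :
    StrictMono (fun m => alphaCurve k m κ) :=
  strictMono_nthRootAfter (h.strictMonoOn_sub hκ) (h.exists_sub_eq_add hκ) (h.F_iff hκ)

lemma F_eq_zero_iff_exists (h : IsBesselPhase k θ) (hκ : 0 < κ) {x : ℝ} (hx : √κ < x) :
    F k κ x = 0 ↔ ∃ n : ℕ, alphaCurve k (n + 1) κ = x :=
  eq_zero_iff_exists_nthRootAfter (h.strictMonoOn_sub hκ) (h.exists_sub_eq_add hκ)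
    (h.F_iff hκ) hx

lemma F_sqrt (h : IsBesselPhase k θ) (hκ : 0 < κ) : F k κ √κ = 0 := by
  rw [h.F_eq_zero_iff hκ (sqrt_pos.mpr hκ), sub_sqrt, sin_zero]

lemma F_alphaCurve (h : IsBesselPhase k θ) (hκ : 0 < κ) (n : ℕ) :
    F k κ (alphaCurve k n κ) = 0 := by
  rcases n with _ | n
  · exact h.F_sqrt hκ
  · refine (h.F_eq_zero_iff_exists hκ ?_).mpr ⟨n, rfl⟩
    exact h.strictMono_alphaCurve hκ n.succ_pos

end alpha

lemma besselZero_pos (h : IsBesselPhase k θ) {n : ℕ} (hn : 1 ≤ n) : 0 < besselZero k n :=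
  h.strictMono_besselZero hn

lemma besselJ_besselZero (h : IsBesselPhase k θ) {n : ℕ} (hn : 1 ≤ n) :
    besselJ k (besselZero k n) = 0 := by
  refine (h.besselJ_eq_zero_iff_exists (h.besselZero_pos hn)).mpr ⟨n - 1, ?_⟩
  rw [Nat.sub_add_cancel hn]

/-- A Bessel phase that counts the roots of `J_i` grows by `ℓ π` over `ℓ` successive roots. -/
lemma sub_besselZero {i : ℕ} {φ : ℝ → ℝ} (h : IsBesselPhase k θ) (hφ : IsBesselPhase i φ)
    (hc : CountsRoots i θ) {n : ℕ} (hn : 1 ≤ n) (ℓ : ℕ) :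
    θ (besselZero i (ℓ + n)) - θ (besselZero i n) = ℓ * π := by
  set y := besselZero i n
  have hy : 0 < y := hφ.besselZero_pos hn
  have hJ : besselJ i y = 0 := hφ.besselJ_besselZero hn
  -- The count restarts at `y`: `θ` measures the growth up to the `ℓ`-th root after `y`, and `φ`,
  -- the angle of `J_i` itself, identifies that root.
  have h1 := (nthRootAfter_phase (h.strictMonoOn_Ici hy.le) (h.exists_eq_add hy.le)
    (fun x hx => hc y x hy (hy.trans hx) hJ) ℓ).2
  have h2 : nthRootAfter (besselJ i) y ℓ = besselZero i (ℓ + n) :=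
    nthRootAfter_eq_of_phase (hφ.strictMonoOn_Ici hy.le) (hφ.exists_eq_add hy.le)
      (fun x hx => hφ.countsRoots y x hy (hy.trans hx) hJ)
      (hφ.strictMono_besselZero.monotone (Nat.le_add_left n ℓ)) (by
        rw [hφ.phase_besselZero, hφ.phase_besselZero]
        push_cast
        ring)
  rw [← h2, h1]
  ring

lemma alphaCurve_mul_besselZero {i : ℕ} {φ : ℝ → ℝ} (h : IsBesselPhase k θ)
    (hφ : IsBesselPhase i φ) (hc : CountsRoots i θ) {n : ℕ} (hn : 1 ≤ n) (ℓ : ℕ) :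
    alphaCurve k ℓ (besselZero i n * besselZero i (ℓ + n)) = besselZero i (ℓ + n) := by
  have hy := hφ.besselZero_pos hn
  have hyx := hφ.strictMono_besselZero.monotone (Nat.le_add_left n ℓ)
  have hx := hy.trans_le hyx
  refine h.alphaCurve_eq (mul_pos hy hx) ?_ ?_
  · exact sqrt_le_iff.mpr ⟨hx.le, by nlinarith⟩
  · rw [mul_div_cancel_right₀ _ hx.ne']
    exact h.sub_besselZero hφ hc hn ℓ

lemma exists_eq_mul_besselZero (h : IsBesselPhase k θ) {κ : ℝ} (hκ : 0 < κ) {ℓ : ℕ}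
    (hx0 : 0 < alphaCurve k ℓ κ) (hy : besselJ k (κ / alphaCurve k ℓ κ) = 0) :
    ∃ n : ℕ, 1 ≤ n ∧ κ = besselZero k n * besselZero k (ℓ + n) := by
  obtain ⟨n, hn⟩ := (h.besselJ_eq_zero_iff_exists (div_pos hκ hx0)).mp hy
  refine ⟨n + 1, by omega, ?_⟩
  have h1 := h.alphaCurve_spec hκ ℓ
  rw [← hn, h.phase_besselZero] at h1
  rw [h.besselZero_eq (n := ℓ + (n + 1)) hx0.le (by push_cast at h1 ⊢; linarith), hn,
    div_mul_cancel₀ _ hx0.ne']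

end IsBesselPhase

/-! ### Common roots of `F_k` and `F_{k+1}`. -/

lemma F_eq_mul_sub (k : ℕ) {κ x y : ℝ} (hxy : κ / x = y) :
    F k κ x = x * (besselJ k y * besselJ (k + 1) x) - y * (besselJ k x * besselJ (k + 1) y) := by
  rw [F, hxy]
  linear_combination besselJ k x * mul_deriv_besselJ k y - besselJ k y * mul_deriv_besselJ k x

lemma F_succ_eq_mul_sub (k : ℕ) {κ x y : ℝ} (hxy : κ / x = y) :
    F (k + 1) κ x =
      y * (besselJ k y * besselJ (k + 1) x) - x * (besselJ k x * besselJ (k + 1) y) := by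
  rw [F, hxy]
  linear_combination besselJ (k + 1) x * mul_deriv_besselJ_succ k y -
    besselJ (k + 1) y * mul_deriv_besselJ_succ k x

lemma besselJ_succ_ne_zero {k : ℕ} {x : ℝ} (hx : 0 < x) (h : besselJ k x = 0) :
    besselJ (k + 1) x ≠ 0 := fun h' => by
  have h1 := besselJ_norm_pos k hx
  rw [eulerBesselJ, mul_deriv_besselJ, h, h'] at h1
  simp at h1

/-- If `F_k` and `F_{k+1}` vanish together off the diagonal, then `J_k` or `J_{k+1}` vanishes
at `κ / x`, and the same function vanishes at `x`. -/
lemma besselJ_div_eq_zero_or {k : ℕ} {κ x : ℝ} (hκ : 0 < κ) (hx : √κ < x) (h1 : F k κ x = 0)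
    (h2 : F (k + 1) κ x = 0) : besselJ k (κ / x) = 0 ∨ besselJ (k + 1) (κ / x) = 0 := by
  have hx0 : 0 < x := (sqrt_nonneg κ).trans_lt hx
  have hy0 : 0 < κ / x := div_pos hκ hx0
  have hyx : κ / x < x := by
    rw [div_lt_iff₀ hx0, ← sq]
    exact (sqrt_lt' hx0).mp hx
  rw [F_eq_mul_sub k rfl] at h1
  rw [F_succ_eq_mul_sub k rfl] at h2
  set y := κ / x
  -- Eliminates the other product from the two linear equations.
  have hA : (x ^ 2 - y ^ 2) * (besselJ k y * besselJ (k + 1) x) = 0 := by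
    linear_combination x * h1 - y * h2
  have hne : x ^ 2 - y ^ 2 ≠ 0 := by nlinarith
  have hA' : besselJ k y * besselJ (k + 1) x = 0 := (mul_eq_zero.mp hA).resolve_left hne
  have hB : besselJ k x * besselJ (k + 1) y = 0 := by
    rw [hA', mul_zero, zero_sub, neg_eq_zero] at h2
    exact (mul_eq_zero.mp h2).resolve_left hx0.ne'
  rcases mul_eq_zero.mp hA' with h | h
  · exact Or.inl h
  -- `J_k` and `J_{k+1}` have no common positive root, so `J_{k+1}(x) = 0` excludes `J_k(x) = 0`.
  · exact Or.inr ((mul_eq_zero.mp hB).resolve_left fun h' => besselJ_succ_ne_zero hx0 h' h)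

end Buckling

end

/-! ### The proposition. -/

theorem mainTheorem8 (k ℓ : ℕ) (hℓ : 1 ≤ ℓ) :
    -- the numbers `j_{i,n}`, `n ≥ 1`, list the positive roots of `J_i` in increasing order
    (∀ i : ℕ, StrictMono (fun n : ℕ => Buckling.besselZero i (n + 1)) ∧
      Set.range (fun n : ℕ => Buckling.besselZero i (n + 1)) =
        {x : ℝ | 0 < x ∧ Buckling.besselJ i x = 0}) ∧
    -- the numbers `α_{i,m}(κ)`, `m ≥ 0`, list the roots of `F_i` in `[√κ, ∞)` in increasing order
    (∀ i : ℕ, ∀ κ : ℝ, 0 < κ → StrictMono (fun m : ℕ => Buckling.alphaCurve i m κ) ∧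
      Set.range (fun m : ℕ => Buckling.alphaCurve i m κ) =
        {x : ℝ | Real.sqrt κ ≤ x ∧ Buckling.F i κ x = 0}) ∧
    -- the crossing points of the two curves
    {κ : ℝ | 0 < κ ∧ Buckling.alphaCurve k ℓ κ = Buckling.alphaCurve (k + 1) ℓ κ} =
      {κ : ℝ | ∃ n : ℕ, 1 ≤ n ∧
        κ = Buckling.besselZero k n * Buckling.besselZero k (ℓ + n)} ∪
      {κ : ℝ | ∃ n : ℕ, 1 ≤ n ∧
        κ = Buckling.besselZero (k + 1) n * Buckling.besselZero (k + 1) (ℓ + n)} := by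
  choose θ hθ using Buckling.exists_isBesselPhase
  refine ⟨fun i => ⟨?_, ?_⟩, fun i κ hκ => ⟨(hθ i).strictMono_alphaCurve hκ, ?_⟩, ?_⟩
  · exact fun m n hmn => (hθ i).strictMono_besselZero (Nat.succ_lt_succ hmn)
  · ext x
    constructor
    · rintro ⟨n, rfl⟩
      exact ⟨(hθ i).besselZero_pos n.succ_pos, (hθ i).besselJ_besselZero n.succ_pos⟩
    · rintro ⟨hx, hJ⟩
      exact ((hθ i).besselJ_eq_zero_iff_exists hx).mp hJ
  · ext x
    constructor
    · rintro ⟨n, rfl⟩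
      exact ⟨((hθ i).strictMono_alphaCurve hκ).monotone n.zero_le, (hθ i).F_alphaCurve hκ n⟩
    · rintro ⟨hx, hF⟩
      rcases hx.eq_or_lt with rfl | hx
      · exact ⟨0, rfl⟩
      · obtain ⟨n, hn⟩ := ((hθ i).F_eq_zero_iff_exists hκ hx).mp hF
        exact ⟨n + 1, hn⟩
  · ext κ
    constructor
    · rintro ⟨hκ, heq⟩
      have hx : Real.sqrt κ < Buckling.alphaCurve k ℓ κ := (hθ k).strictMono_alphaCurve hκ hℓ
      have hx0 := (Real.sqrt_nonneg κ).trans_lt hx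
      rcases Buckling.besselJ_div_eq_zero_or hκ hx ((hθ k).F_alphaCurve hκ ℓ)
        (heq ▸ (hθ (k + 1)).F_alphaCurve hκ ℓ) with h | h
      · exact Or.inl ((hθ k).exists_eq_mul_besselZero hκ hx0 h)
      -- The root at `κ / x` now belongs to `J_{k+1}`, so the common point is read as one of the
      -- curve of order `k + 1`.
      · rw [heq] at hx0 h
        exact Or.inr ((hθ (k + 1)).exists_eq_mul_besselZero hκ hx0 h)
    · rintro (⟨n, hn, rfl⟩ | ⟨n, hn, rfl⟩)
      · refine ⟨mul_pos ((hθ k).besselZero_pos hn)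
          ((hθ k).besselZero_pos (hn.trans (Nat.le_add_left n ℓ))), ?_⟩
        rw [(hθ k).alphaCurve_mul_besselZero (hθ k) (hθ k).countsRoots hn,
          (hθ (k + 1)).alphaCurve_mul_besselZero (hθ k) (hθ (k + 1)).countsRoots_pred hn]
      · refine ⟨mul_pos ((hθ (k + 1)).besselZero_pos hn)
          ((hθ (k + 1)).besselZero_pos (hn.trans (Nat.le_add_left n ℓ))), ?_⟩
        rw [(hθ k).alphaCurve_mul_besselZero (hθ (k + 1)) (hθ k).countsRoots_succ hn,
          (hθ (k + 1)).alphaCurve_mul_besselZero (hθ (k + 1)) (hθ (k + 1)).countsRoots hn]
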